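/- Let $(n_k)_{k\ge 1}$ be a sequence of integers with $n_k\ge 2$. Let $\xi_1,\xi_2,\dots$ be independent random variables such that $\xi_k$ takes the values $0,1,\dots,n_k-1$ with probabilities $p_{0k},p_{1k},\dots,p_{n_k-1,k}$ respectively, and let $\mu_\xi$ be the distribution on $\mathbb{R}$ (concentrated on $[0,1]$) of the random variable $$\xi=\sum_{k=1}^{\infty}\frac{\xi_k}{n_1n_2\cdots n_k}.$$ Put $h_j=-\sum_{i=0}^{n_j-1}p_{ij}\ln p_{ij}$ (with $0\ln 0=0$) and $H_k=\sum_{j=1}^{k}h_j$. For a Borel probability measure $\mu$ on $\mathbb{R}$ let $\dim_H\mu=\inf\{\dim_H E:\ E \text{ Borel},\ \mu(E)=1\}$, where $\dim_H E$ is the classical Hausdorff dimension of the set $E$. If $$\sum_{k=1}^{\infty}\left(\frac{\ln n_k}{\ln(n_1n_2\cdots n_k)}\right)^2<\infty,$$ then $$\dim_H(\mu_\xi)=\liminf_{k\to\infty}\frac{H_k}{\ln(n_1n_2\cdots n_k)}.$$ -/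

import Mathlib

open MeasureTheory ProbabilityTheory Filter

/-- The product `n₁ n₂ ⋯ nₖ`, with indices counted from `0`: `cantorProd n k = n 0 * ⋯ * n k`
is the denominator belonging to the digit number `k`. -/
def cantorProd (n : ℕ → ℕ) (k : ℕ) : ℕ := ∏ j ∈ Finset.range (k + 1), n j

/-- The real number with digits `α` in the Cantor series expansion with bases `n`,
`∑ₖ αₖ / (n₀ n₁ ⋯ nₖ)`. -/
noncomputable def cantorSum (n : ℕ → ℕ) (α : (k : ℕ) → Fin (n k)) : ℝ :=
  ∑' k : ℕ, ((α k : ℕ) : ℝ) / (cantorProd n k : ℝ)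

/-- The entropy `hⱼ = - ∑ᵢ pᵢⱼ ln pᵢⱼ` of the `j`-th digit (`0 ln 0 = 0`). -/
noncomputable def digitEntropy (n : ℕ → ℕ) (p : (k : ℕ) → Fin (n k) → ℝ) (j : ℕ) : ℝ :=
  -∑ i : Fin (n j), p j i * Real.log (p j i)

/-- The sum `h₀ + ⋯ + hₖ` of the entropies of the digits up to (and including) number `k`. -/
noncomputable def entropySum (n : ℕ → ℕ) (p : (k : ℕ) → Fin (n k) → ℝ) (k : ℕ) : ℝ :=
  ∑ j ∈ Finset.range (k + 1), digitEntropy n p j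

/-- The Hausdorff dimension of a probability measure: the infimum of the Hausdorff dimensions
of the measurable sets of full measure. -/
noncomputable def measureDimH {X : Type*} [EMetricSpace X] [MeasurableSpace X] [BorelSpace X]
    (μ : Measure X) : ENNReal :=
  ⨅ (E : Set X) (_ : MeasurableSet E) (_ : μ E = 1), dimH E

/-!
The dimension is computed from the probabilities of the cylinders. Let `N k = n 0 ⋯ n k`. The first
`k + 1` digits of `ξ` determine an integer `digitIndex` in `[0, N k)`, and `ξ` lies in the closed
interval of length `1 / N k` with that rank. By independence the probability that these digits
occur is `exp (-L k)`, where `L k` is the sum of the informations `-log p (ξ j)`.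

The information of the digit `j` has mean `h j`, and its variance is at most `68 (log (n j)) ^ 2`
(`sum_mul_log_sq_le`). The summability condition is therefore the one of Kolmogorov's strong law
with the norming sequence `log (N k)`, and `(L k - H k) / log (N k)` tends to `0` almost surely
(`ae_tendsto_information_sub_entropySum`). The strong law itself follows from martingale convergence
and Kronecker's lemma.

If `s` is larger than the lower limit of `H k / log (N k)`, then almost surely `ξ` lies in
infinitely many intervals of probability at least `N k ^ (-s)`. There are at most `N k ^ s` of them
for each `k`, so their limsup set has dimension at most `s`
(`exists_dimH_le_of_ae_frequently_le_measure`). If `s` is smaller, then almost surely all but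
finitely many of the intervals around `ξ` have probability at most `N k ^ (-s)`, and the mass
distribution principle applies (`le_dimH_of_ae_eventually_measure_le`). The summability condition
enters here once more: it gives `log (n k) / log (N k) → 0`, so that covering sets with diameters
between two consecutive scales `1 / N k` cost an arbitrarily small part of the exponent.
-/

/-! ### The strong law of large numbers for independent variables -/

open scoped Topology in
/-- **Kronecker's lemma**, by summation by parts: the terms `b j * x j` are written through the
tails of `∑ x j`, which are then averaged with the weights `b (j + 1) - b j`. -/
theorem tendsto_sum_mul_div_of_tendsto_sum {b x : ℕ → ℝ} {c : ℝ} (hmono : Monotone b)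
    (hb : Tendsto b atTop atTop)
    (hx : Tendsto (fun m => ∑ j ∈ Finset.range m, x j) atTop (𝓝 c)) :
    Tendsto (fun m => (∑ j ∈ Finset.range (m + 1), b j * x j) / b m) atTop (𝓝 0) := by
  set T : ℕ → ℝ := fun m => ∑ j ∈ Finset.range m, x j with hT
  have hT1 : Tendsto (fun m => T (m + 1) - c) atTop (𝓝 0) := by
    have := ((tendsto_add_atTop_iff_nat 1).2 hx).sub_const c
    simpa using this
  have hparts : ∀ m, ∑ j ∈ Finset.range (m + 1), b j * x j =
      (T (m + 1) - c) * b m - ∑ j ∈ Finset.range m, (T (j + 1) - c) * (b (j + 1) - b j)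
        + b 0 * c := by
    intro m
    induction m with
    | zero => simp [hT]; ring
    | succ m ih =>
      rw [Finset.sum_range_succ, ih, Finset.sum_range_succ _ m]
      have : T (m + 1 + 1) = T (m + 1) + x (m + 1) := by simp [hT, Finset.sum_range_succ]
      rw [this]; ring
  have hbconst : (fun _ : ℕ => b 0) =o[atTop] b :=
    (Asymptotics.isLittleO_const_left.2 (Or.inr (tendsto_norm_atTop_atTop.comp hb)))
  have h1 : (fun m => (T (m + 1) - c) * b m) =o[atTop] b := by
    simpa using
      ((Asymptotics.isLittleO_one_iff ℝ).2 hT1).mul_isBigO (Asymptotics.isBigO_refl b atTop)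
  have hsum : ∀ m, ∑ j ∈ Finset.range m, (b (j + 1) - b j) = b m - b 0 :=
    fun m => Finset.sum_range_sub b m
  have h2 : (fun m => ∑ j ∈ Finset.range m, (T (j + 1) - c) * (b (j + 1) - b j)) =o[atTop] b := by
    have h := Asymptotics.IsLittleO.sum_range
      (f := fun j => (T (j + 1) - c) * (b (j + 1) - b j)) (g := fun j => b (j + 1) - b j)
      (by
        have h := ((Asymptotics.isLittleO_one_iff ℝ).2 hT1).mul_isBigO
          (Asymptotics.isBigO_refl (fun j => b (j + 1) - b j) atTop)
        simpa using h)
      (fun j => sub_nonneg.2 (hmono j.le_succ))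
      (by simp_rw [hsum]; exact tendsto_atTop_add_const_right _ _ hb)
    simp_rw [hsum] at h
    exact h.trans_isBigO ((Asymptotics.isBigO_refl b atTop).sub hbconst.isBigO)
  have h3 : (fun _ : ℕ => b 0 * c) =o[atTop] b :=
    (Asymptotics.isLittleO_const_left.2 (Or.inr (tendsto_norm_atTop_atTop.comp hb)))
  simp_rw [hparts]
  exact ((h1.sub h2).add h3).tendsto_div_nhds_zero

open scoped Topology in
/-- The partial sums are a martingale bounded in `L²`, hence in `L¹`. -/
theorem ae_exists_tendsto_sum_of_iIndepFun {Ω : Type*} [MeasurableSpace Ω] {P : Measure Ω}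
    [IsProbabilityMeasure P] {X : ℕ → Ω → ℝ} (hm : ∀ i, Measurable (X i))
    (h2 : ∀ i, MemLp (X i) 2 P) (hind : iIndepFun X P) (hmean : ∀ i, ∫ ω, X i ω ∂P = 0)
    (hvar : Summable fun i => variance (X i) P) :
    ∀ᵐ ω ∂P, ∃ c, Tendsto (fun m => ∑ j ∈ Finset.range m, X j ω) atTop (𝓝 c) := by
  have hsm : ∀ i, StronglyMeasurable (X i) := fun i => (hm i).stronglyMeasurable
  have hint : ∀ i, Integrable (X i) P := fun i => (h2 i).integrable (by norm_num)
  set ℱ := Filtration.natural X hsm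
  set S : ℕ → Ω → ℝ := fun m => ∑ j ∈ Finset.range (m + 1), X j with hS
  have hS2 : ∀ m, MemLp (S m) 2 P := fun m => memLp_finsetSum' _ fun i _ => h2 i
  have hSint : ∀ m, Integrable (S m) P := fun m => (hS2 m).integrable (by norm_num)
  have hmart : Martingale S ℱ P := by
    refine martingale_of_condExp_sub_eq_zero_nat (fun m => ?_) hSint fun m => ?_
    · refine Finset.stronglyMeasurable_sum _ fun i hi => ?_
      exact (Filtration.stronglyAdapted_natural hsm i).mono
        (ℱ.mono (Nat.lt_succ_iff.1 (Finset.mem_range.1 hi)))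
    · have h : S (m + 1) - S m = X (m + 1) := by
        simp only [hS, Finset.sum_range_succ _ (m + 1)]; simp
      rw [h]
      have := hind.condExp_natural_ae_eq_of_lt hsm (Nat.lt_succ_self m)
      simp only [hmean] at this
      exact this
  have hSmean : ∀ m, ∫ ω, S m ω ∂P = 0 := by
    intro m
    simp only [hS, Finset.sum_apply]
    rw [integral_finsetSum _ fun i _ => hint i]
    simp [hmean]
  have hSsq : ∀ m, ∫ ω, (S m ω) ^ 2 ∂P ≤ ∑' i, variance (X i) P := by
    intro m
    have h := variance_of_integral_eq_zero (hS2 m).aemeasurable (hSmean m)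
    rw [← h, hS, IndepFun.variance_sum (fun i _ => h2 i)
      (fun i _ j _ hij => hind.indepFun hij)]
    exact hvar.sum_le_tsum _ fun i _ => variance_nonneg _ _
  have hbdd : ∀ m, eLpNorm (S m) 1 P ≤ (Real.toNNReal (1 + ∑' i, variance (X i) P) : NNReal) := by
    intro m
    rw [eLpNorm_one_eq_lintegral_enorm, ← ofReal_integral_norm_eq_lintegral_enorm (hSint m)]
    refine ENNReal.ofReal_le_ofReal ?_
    calc ∫ ω, ‖S m ω‖ ∂P ≤ ∫ ω, (1 + (S m ω) ^ 2) ∂P := by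
          refine integral_mono (hSint m).norm ((integrable_const _).add (hS2 m).integrable_sq) ?_
          intro ω
          simp only [Real.norm_eq_abs]
          nlinarith [sq_nonneg (|S m ω| - 1), sq_abs (S m ω), abs_nonneg (S m ω)]
      _ = 1 + ∫ ω, (S m ω) ^ 2 ∂P := by
          rw [integral_add (integrable_const _) (hS2 m).integrable_sq]; simp
      _ ≤ _ := by linarith [hSsq m]
  filter_upwards [hmart.submartingale.exists_ae_tendsto_of_bdd hbdd] with ω ⟨c, hc⟩
  refine ⟨c, (tendsto_add_atTop_iff_nat 1).1 ?_⟩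
  simpa [hS] using hc

open scoped Topology in
/-- **Kolmogorov's strong law of large numbers** for independent, not necessarily identically
distributed, square integrable variables and the norming sequence `b`. -/
theorem ae_tendsto_sum_sub_integral_div {Ω : Type*} [MeasurableSpace Ω] {P : Measure Ω}
    [IsProbabilityMeasure P] {X : ℕ → Ω → ℝ} {b : ℕ → ℝ} (hm : ∀ i, Measurable (X i))
    (h2 : ∀ i, MemLp (X i) 2 P) (hind : iIndepFun X P) (hb0 : ∀ i, 0 < b i) (hmono : Monotone b)
    (hb : Tendsto b atTop atTop) (hvar : Summable fun i => variance (X i) P / b i ^ 2) :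
    ∀ᵐ ω ∂P, Tendsto (fun m => (∑ j ∈ Finset.range (m + 1), (X j ω - ∫ ω', X j ω' ∂P)) / b m)
      atTop (𝓝 0) := by
  set Y : ℕ → Ω → ℝ := fun i ω => (b i)⁻¹ * (X i ω - ∫ ω', X i ω' ∂P) with hY
  have hYm : ∀ i, Measurable (Y i) := fun i => ((hm i).sub_const _).const_mul _
  have hsub2 : ∀ i, MemLp (fun ω => X i ω - ∫ ω', X i ω' ∂P) 2 P :=
    fun i => (h2 i).sub (memLp_const _)
  have hconv := ae_exists_tendsto_sum_of_iIndepFun (P := P) (X := Y) hYm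
    (fun i => (hsub2 i).const_mul _)
    (hind.comp (fun i x => (b i)⁻¹ * (x - ∫ ω', X i ω' ∂P)) fun i => by fun_prop)
    (fun i => by
      simp only [hY]
      rw [integral_const_mul, integral_sub ((h2 i).integrable (by norm_num)) (integrable_const _)]
      simp)
    (by
      refine hvar.congr fun i => ?_
      simp only [hY]
      rw [variance_const_mul, variance_sub_const (h2 i).aestronglyMeasurable]
      field_simp)
  filter_upwards [hconv] with ω ⟨c, hc⟩
  refine (tendsto_sum_mul_div_of_tendsto_sum hmono hb hc).congr fun m => ?_
  congr 1
  refine Finset.sum_congr rfl fun j _ => ?_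
  simp only [hY]
  rw [mul_inv_cancel_left₀ (hb0 j).ne']

/-! ### Dimension bounds from grid approximations -/

/-- Mass distribution principle along a grid. The numbers `Z k ω` locate `X ω` in the grid of mesh
`1 / N k`; a set of diameter at most `1 / N k` meets at most five of the cells charged by `X`, and
only cells of small probability are seen on a suitable event of positive probability. -/
theorem le_dimH_of_ae_eventually_measure_le {Ω : Type*} [MeasurableSpace Ω] {P : Measure Ω}
    [IsProbabilityMeasure P] {X : Ω → ℝ} (hX : Measurable X) {N : ℕ → ℕ} (hN0 : ∀ k, 0 < N k)
    (hN : Tendsto N atTop atTop) {Z : ℕ → Ω → ℕ}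
    (hZ : ∀ k, Measurable (Z k)) (hle : ∀ k ω, (Z k ω : ℝ) ≤ X ω * N k)
    (hge : ∀ k ω, X ω * N k ≤ Z k ω + 1) {s : ℝ} {t : NNReal} (hs : 0 < s)
    (hst : ∀ᶠ k in atTop, (N (k + 1) : ℝ) ^ (t : ℝ) ≤ (N k : ℝ) ^ s)
    (hP : ∀ᵐ ω ∂P, ∀ᶠ k in atTop, P {ω' | Z k ω' = Z k ω} ≤ ENNReal.ofReal ((N k : ℝ) ^ (-s)))
    {E : Set ℝ} (hE : MeasurableSet E) (hE1 : P.map X E = 1) : (t : ENNReal) ≤ dimH E := by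
  obtain ⟨K₀, hK₀⟩ := eventually_atTop.1 hst
  -- An event of positive probability on which the cell probabilities are uniformly small.
  set A : ℕ → Set Ω := fun K =>
    {ω | ∀ k ≥ K, P {ω' | Z k ω' = Z k ω} ≤ ENNReal.ofReal ((N k : ℝ) ^ (-s))} with hA
  have hAm : ∀ K, MeasurableSet (A K) := by
    intro K
    have : A K = ⋂ k ≥ K, Z k ⁻¹' {m | P {ω' | Z k ω' = m} ≤ ENNReal.ofReal ((N k : ℝ) ^ (-s))} := by
      ext ω; simp [hA]
    rw [this]
    exact MeasurableSet.iInter fun k => MeasurableSet.iInter fun _ => hZ k (MeasurableSet.of_discrete)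
  obtain ⟨K, hKK, hK⟩ : ∃ K ≥ K₀, P (A K) ≠ 0 := by
    by_contra! h
    have h0 : P (⋃ K, A (K + K₀)) = 0 :=
      measure_iUnion_null fun K => h _ (Nat.le_add_left _ _)
    have h1 : ∀ᵐ ω ∂P, False := by
      filter_upwards [hP, measure_eq_zero_iff_ae_notMem.1 h0] with ω h1 h2
      obtain ⟨K, hK⟩ := eventually_atTop.1 h1
      exact h2 (Set.mem_iUnion.2 ⟨K, fun k hk => hK k (le_trans (Nat.le_add_right _ _) hk)⟩)
    simp [IsProbabilityMeasure.ne_zero P] at h1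
  have hNR : ∀ k, (0 : ℝ) < N k := fun k => by exact_mod_cast hN0 k
  set ν : Measure ℝ := (P.restrict (A K)).map X with hν
  have hνapp : ∀ S : Set ℝ, MeasurableSet S → ν S = P (X ⁻¹' S ∩ A K) := by
    intro S hS
    rw [hν, Measure.map_apply hX hS, Measure.restrict_apply (hX hS)]
  have hcell : ∀ S : Set ℝ, MeasurableSet S → ∀ k ≥ K,
      Metric.ediam S ≤ ENNReal.ofReal ((N k : ℝ)⁻¹) →
      ν S ≤ 5 * ENNReal.ofReal ((N k : ℝ) ^ (-s)) := by
    intro S hS k hk hdiam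
    rw [hνapp S hS]
    rcases Set.eq_empty_or_nonempty (X ⁻¹' S ∩ A K) with h | ⟨ω₀, hω₀, -⟩
    · simp [h]
    have hcov : X ⁻¹' S ∩ A K ⊆
        ⋃ m ∈ Finset.Icc (Z k ω₀ - 2) (Z k ω₀ + 2), {ω | Z k ω = m} ∩ A K := by
      rintro ω ⟨hω, hωA⟩
      have hd : dist (X ω) (X ω₀) ≤ (N k : ℝ)⁻¹ := by
        rw [← ENNReal.ofReal_le_ofReal_iff (by have := hNR k; positivity), ← edist_dist]
        exact (Metric.edist_le_ediam_of_mem (s := S) hω hω₀).trans hdiam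
      rw [Real.dist_eq, abs_le] at hd
      have e : (N k : ℝ)⁻¹ * N k = 1 := inv_mul_cancel₀ (hNR k).ne'
      have h1 : X ω * N k ≤ X ω₀ * N k + 1 := by nlinarith [hNR k, hd.2]
      have h2 : X ω₀ * N k ≤ X ω * N k + 1 := by nlinarith [hNR k, hd.1]
      have h3 : (Z k ω : ℝ) ≤ Z k ω₀ + 2 := by linarith [hle k ω, hge k ω₀]
      have h4 : (Z k ω₀ : ℝ) ≤ Z k ω + 2 := by linarith [hle k ω₀, hge k ω]
      have h3' : Z k ω ≤ Z k ω₀ + 2 := by exact_mod_cast h3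
      have h4' : Z k ω₀ ≤ Z k ω + 2 := by exact_mod_cast h4
      simp only [Set.mem_iUnion]
      exact ⟨Z k ω, Finset.mem_Icc.2 ⟨by omega, h3'⟩, rfl, hωA⟩
    calc P (X ⁻¹' S ∩ A K)
        ≤ ∑ m ∈ Finset.Icc (Z k ω₀ - 2) (Z k ω₀ + 2), P ({ω | Z k ω = m} ∩ A K) :=
          (measure_mono hcov).trans (measure_biUnion_finset_le _ _)
      _ ≤ ∑ m ∈ Finset.Icc (Z k ω₀ - 2) (Z k ω₀ + 2), ENNReal.ofReal ((N k : ℝ) ^ (-s)) := by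
          refine Finset.sum_le_sum fun m _ => ?_
          rcases Set.eq_empty_or_nonempty ({ω | Z k ω = m} ∩ A K) with h | ⟨ω₁, h1, h2⟩
          · simp [h]
          · have := h2 k hk
            rw [show Z k ω₁ = m from h1] at this
            exact (measure_mono Set.inter_subset_left).trans this
      _ ≤ _ := by
          rw [Finset.sum_const, nsmul_eq_mul]
          gcongr
          have : (Finset.Icc (Z k ω₀ - 2) (Z k ω₀ + 2)).card ≤ 5 := by
            rw [Nat.card_Icc]; omega
          exact_mod_cast this
  have hNtop : Tendsto (fun k => (N k : ℝ)) atTop atTop := tendsto_natCast_atTop_atTop.comp hN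
  have hball : ∀ S : Set ℝ, MeasurableSet S →
      Metric.ediam S ≤ ENNReal.ofReal ((N K : ℝ)⁻¹) → ν S ≤ 5 * Metric.ediam S ^ (t : ℝ) := by
    intro S hS hdiam
    rcases eq_or_ne (Metric.ediam S) 0 with h0 | h0
    · rw [h0]
      have hlim : Tendsto (fun k => 5 * ENNReal.ofReal ((N k : ℝ) ^ (-s))) atTop (nhds 0) := by
        have := ENNReal.tendsto_ofReal ((tendsto_rpow_neg_atTop hs).comp hNtop)
        have := ENNReal.Tendsto.const_mul (a := 5) this (Or.inr (by simp))
        simpa using this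
      refine le_trans (ge_of_tendsto hlim ?_) (zero_le)
      filter_upwards [eventually_ge_atTop K] with k hk
      exact hcell S hS k hk (by rw [h0]; exact zero_le)
    · -- The last scale `k` at which the diameter of `S` is at most `1 / N k`.
      have hinv : Tendsto (fun k => ENNReal.ofReal ((N k : ℝ)⁻¹)) atTop (nhds 0) := by
        simpa using ENNReal.tendsto_ofReal (tendsto_inv_atTop_zero.comp hNtop)
      have hex : ∃ j, ENNReal.ofReal ((N (K + j) : ℝ)⁻¹) < Metric.ediam S := by
        have := (hinv.eventually (gt_mem_nhds (pos_iff_ne_zero.2 h0)))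
        obtain ⟨k, hk⟩ := eventually_atTop.1 this
        exact ⟨k, hk _ (Nat.le_add_left _ _)⟩
      classical
      obtain ⟨j, hj⟩ : ∃ j, Nat.find hex = j + 1 := by
        refine Nat.exists_eq_succ_of_ne_zero fun h => ?_
        have := Nat.find_spec hex
        rw [h] at this
        exact absurd hdiam (not_le.2 this)
      have hj1 : ENNReal.ofReal ((N (K + j + 1) : ℝ)⁻¹) < Metric.ediam S := by
        have := Nat.find_spec hex
        rwa [hj] at this
      have hj2 : Metric.ediam S ≤ ENNReal.ofReal ((N (K + j) : ℝ)⁻¹) :=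
        not_lt.1 (Nat.find_min hex (by omega : j < Nat.find hex))
      refine (hcell S hS (K + j) (Nat.le_add_right _ _) hj2).trans ?_
      gcongr
      calc ENNReal.ofReal ((N (K + j) : ℝ) ^ (-s))
          ≤ ENNReal.ofReal (((N (K + j + 1) : ℝ)⁻¹) ^ (t : ℝ)) := by
            refine ENNReal.ofReal_le_ofReal ?_
            rw [Real.rpow_neg (hNR _).le, Real.inv_rpow (hNR _).le]
            exact inv_anti₀ (Real.rpow_pos_of_pos (hNR _) _) (hK₀ (K + j) (by omega))
        _ = ENNReal.ofReal ((N (K + j + 1) : ℝ)⁻¹) ^ (t : ℝ) :=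
            (ENNReal.ofReal_rpow_of_nonneg (inv_nonneg.2 (hNR _).le) t.2).symm
        _ ≤ _ := ENNReal.rpow_le_rpow hj1.le t.2
  have hmain : (5 : ENNReal)⁻¹ • ν ≤ Measure.hausdorffMeasure (t : ℝ) := by
    refine Measure.le_hausdorffMeasure _ _ (ENNReal.ofReal ((N K : ℝ)⁻¹))
      (ENNReal.ofReal_pos.2 (inv_pos.2 (hNR K))) fun S hS => ?_
    have h := hball (closure S) isClosed_closure.measurableSet (by rwa [Metric.ediam_closure])
    rw [Metric.ediam_closure] at h
    rw [Measure.smul_apply, smul_eq_mul, ENNReal.inv_mul_le_iff (by simp) (by simp)]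
    exact (measure_mono subset_closure).trans h
  refine le_dimH_of_hausdorffMeasure_ne_zero fun h0 => hK ?_
  have hνE : ν E = 0 := by
    have := hmain E
    rw [h0, Measure.smul_apply, smul_eq_mul] at this
    simpa using this
  rw [Measure.map_apply hX hE] at hE1
  rw [hνapp E hE] at hνE
  rwa [Set.inter_comm, ← Set.sdiff_compl,
    measure_sdiff_null ((prob_compl_eq_zero_iff (hX hE)).2 hE1)] at hνE

/-- For every `k` at most `(N k) ^ s` grid cells have probability at least `(N k) ^ (-s)`; the set of
points lying in infinitely many of these cells has dimension at most `s` and full measure. -/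
theorem exists_dimH_le_of_ae_frequently_le_measure {Ω : Type*} [MeasurableSpace Ω] {P : Measure Ω}
    [IsProbabilityMeasure P] {X : Ω → ℝ} (hX : Measurable X) {N : ℕ → ℕ}
    (hN : ∀ k, 2 ^ k ≤ N k) {Z : ℕ → Ω → ℕ}
    (hZ : ∀ k, Measurable (Z k)) (hle : ∀ k ω, (Z k ω : ℝ) ≤ X ω * N k)
    (hge : ∀ k ω, X ω * N k ≤ Z k ω + 1) (hlt : ∀ k ω, Z k ω < N k) {s : NNReal}
    (hP : ∀ᵐ ω ∂P, ∃ᶠ k in atTop,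
      ENNReal.ofReal ((N k : ℝ) ^ (-s : ℝ)) ≤ P {ω' | Z k ω' = Z k ω}) :
    ∃ E : Set ℝ, MeasurableSet E ∧ P.map X E = 1 ∧ dimH E ≤ s := by
  classical
  have hN0 : ∀ k, 0 < N k := fun k => (pow_pos two_pos k).trans_le (hN k)
  have hNR : ∀ k, (0 : ℝ) < N k := fun k => by exact_mod_cast hN0 k
  set G : ℕ → Finset ℕ := fun k => (Finset.range (N k)).filter fun m =>
    ENNReal.ofReal ((N k : ℝ) ^ (-s : ℝ)) ≤ P {ω' | Z k ω' = m} with hG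
  set I : ℕ → ℕ → Set ℝ := fun k m => Set.Icc ((m : ℝ) / N k) ((m + 1 : ℝ) / N k) with hI
  set E : Set ℝ := {x | ∃ᶠ k in atTop, ∃ m ∈ G k, x ∈ I k m} with hEdef
  have hEm : MeasurableSet E := by
    have : E = ⋂ K, ⋃ k ≥ K, ⋃ m ∈ G k, I k m := by
      ext x; simp [hEdef, frequently_atTop]
    rw [this]
    exact MeasurableSet.iInter fun K => MeasurableSet.iUnion fun k => MeasurableSet.iUnion fun _ =>
      Finset.measurableSet_biUnion _ fun m _ => measurableSet_Icc
  have hcard : ∀ k, ((G k).card : ENNReal) ≤ ENNReal.ofReal ((N k : ℝ) ^ (s : ℝ)) := by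
    intro k
    have hpos : (0 : ℝ) < (N k : ℝ) ^ (s : ℝ) := Real.rpow_pos_of_pos (hNR k) _
    have h1 : ((G k).card : ENNReal) * ENNReal.ofReal ((N k : ℝ) ^ (-s : ℝ)) ≤ 1 := by
      calc _ = ∑ m ∈ G k, ENNReal.ofReal ((N k : ℝ) ^ (-s : ℝ)) := by simp
        _ ≤ ∑ m ∈ G k, P {ω' | Z k ω' = m} :=
            Finset.sum_le_sum fun m hm => (Finset.mem_filter.1 hm).2
        _ = P (⋃ m ∈ G k, {ω' | Z k ω' = m}) := by
            refine (measure_biUnion_finset ?_ fun m _ => hZ k (measurableSet_singleton m)).symm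
            intro i _ j _ hij
            exact Set.disjoint_left.2 fun ω h1 h2 => hij (h1.symm.trans h2)
        _ ≤ 1 := prob_le_one
    rw [Real.rpow_neg (hNR k).le, ENNReal.ofReal_inv_of_pos hpos, ← div_eq_mul_inv] at h1
    rw [ENNReal.div_le_iff (by simpa using hpos) (by simp)] at h1
    simpa using h1
  have hdiam : ∀ k m, Metric.ediam (I k m) = ENNReal.ofReal ((N k : ℝ)⁻¹) := by
    intro k m
    rw [hI, Real.ediam_Icc]
    congr 1
    field_simp
    ring
  refine ⟨E, hEm, ?_, ?_⟩
  · rw [Measure.map_apply hX hEm, ← prob_compl_eq_zero_iff (hX hEm)]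
    change ∀ᵐ ω ∂P, X ω ∈ E
    filter_upwards [hP] with ω hω
    refine hω.mono fun k hk => ⟨Z k ω, ?_, ?_⟩
    · exact Finset.mem_filter.2 ⟨Finset.mem_range.2 (hlt k ω), hk⟩
    · exact ⟨(div_le_iff₀ (hNR k)).2 (hle k ω), (le_div_iff₀ (hNR k)).2 (hge k ω)⟩
  · refine ENNReal.le_of_forall_pos_le_add fun δ hδ _ => ?_
    rw [← ENNReal.coe_add]
    refine dimH_le_of_hausdorffMeasure_ne_top (ne_of_lt (lt_of_le_of_lt ?_ ENNReal.one_lt_top))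
    set c : ENNReal := ENNReal.ofReal ((2 : ℝ) ^ (-δ : ℝ)) with hc
    have hterm : ∀ k, ((G k).card : ENNReal) * ENNReal.ofReal ((N k : ℝ)⁻¹) ^ ((s + δ : NNReal) : ℝ)
        ≤ c ^ k := by
      intro k
      calc _ ≤ ENNReal.ofReal ((N k : ℝ) ^ (s : ℝ)) *
            ENNReal.ofReal ((N k : ℝ)⁻¹ ^ ((s + δ : NNReal) : ℝ)) := by
            rw [ENNReal.ofReal_rpow_of_nonneg (inv_nonneg.2 (hNR k).le) (s + δ).coe_nonneg]
            gcongr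
            exact hcard k
        _ = ENNReal.ofReal ((N k : ℝ) ^ (-δ : ℝ)) := by
            rw [← ENNReal.ofReal_mul (by positivity), Real.inv_rpow (hNR k).le,
              ← Real.rpow_neg (hNR k).le, ← Real.rpow_add (hNR k)]
            congr 2
            push_cast; ring
        _ ≤ ENNReal.ofReal (((2 : ℝ) ^ k) ^ (-δ : ℝ)) := by
            refine ENNReal.ofReal_le_ofReal ?_
            exact Real.rpow_le_rpow_of_nonpos (by positivity) (by exact_mod_cast hN k) (by simp)
        _ = c ^ k := by
            rw [hc, ← ENNReal.ofReal_pow (by positivity), ← Real.rpow_natCast, ← Real.rpow_natCast,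
              ← Real.rpow_mul (by norm_num), ← Real.rpow_mul (by norm_num), mul_comm]
    have hc1 : c < 1 := by
      rw [hc, ENNReal.ofReal_lt_one]
      exact Real.rpow_lt_one_of_one_lt_of_neg (by norm_num) (by simpa using hδ)
    have hsumc : ∑' k, c ^ k ≠ ⊤ := by
      rw [ENNReal.tsum_geometric]; simpa [tsub_eq_zero_iff_le] using hc1
    have hcover := Measure.hausdorffMeasure_le_liminf_tsum (ι := fun _ : ℕ => Σ k : ℕ, G k)
      ((s + δ : NNReal) : ℝ) E (l := atTop) (fun K => ENNReal.ofReal (((2 : ℝ) ^ K)⁻¹))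
      (by
        have : Tendsto (fun K : ℕ => ((2 : ℝ) ^ K)⁻¹) atTop (nhds 0) :=
          tendsto_inv_atTop_zero.comp (tendsto_pow_atTop_atTop_of_one_lt (by norm_num))
        simpa using ENNReal.tendsto_ofReal this)
      (fun K km => if K ≤ km.1 then I km.1 km.2 else ∅)
      (Eventually.of_forall fun K km => by
        split_ifs with h
        · rw [hdiam]
          refine ENNReal.ofReal_le_ofReal (inv_anti₀ (by positivity) ?_)
          exact_mod_cast (Nat.pow_le_pow_right two_pos h).trans (hN km.1)
        · simp)
      (Eventually.of_forall fun K x hx => by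
        obtain ⟨k, hk, m, hm, hxm⟩ := frequently_atTop.1 hx K
        refine Set.mem_iUnion.2 ⟨⟨k, ⟨m, hm⟩⟩, ?_⟩
        simpa [hk] using hxm)
    refine hcover.trans ?_
    have hsδ : (0 : ℝ) < s + δ := by positivity
    have hle1 : ∀ K, ∑' km : (Σ k : ℕ, G k),
        Metric.ediam (if K ≤ km.1 then I km.1 km.2 else ∅) ^ ((s + δ : NNReal) : ℝ) ≤
          ∑' k, if K ≤ k then c ^ k else 0 := by
      intro K
      rw [ENNReal.tsum_sigma (fun k (m : G k) =>
        Metric.ediam (if K ≤ k then I k m else ∅) ^ ((s + δ : NNReal) : ℝ))]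
      refine ENNReal.tsum_le_tsum fun k => ?_
      split_ifs with h
      · simp_rw [hdiam]
        rw [ENNReal.tsum_const]
        simpa using hterm k
      · simp [hsδ]
    have htail' : Tendsto (fun K : ℕ => ∑' k, if K ≤ k then c ^ k else 0) atTop (nhds 0) := by
      have h := ENNReal.tendsto_sum_nat_add (fun k => c ^ k) hsumc
      refine h.congr fun K => ?_
      rw [← ENNReal.summable.sum_add_tsum_nat_add' (f := fun k => if K ≤ k then c ^ k else 0) (k := K)]
      rw [Finset.sum_eq_zero fun i hi => if_neg (not_le.2 (Finset.mem_range.1 hi))]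
      simp
    refine (liminf_le_liminf (Eventually.of_forall hle1)).trans ?_
    rw [htail'.liminf_eq]
    exact zero_le_one

/-! ### Cantor series expansions -/

theorem cantorProd_zero (n : ℕ → ℕ) : cantorProd n 0 = n 0 := by simp [cantorProd]

theorem cantorProd_succ (n : ℕ → ℕ) (k : ℕ) :
    cantorProd n (k + 1) = cantorProd n k * n (k + 1) := Finset.prod_range_succ _ _

theorem two_pow_le_cantorProd {n : ℕ → ℕ} (hn : ∀ k, 2 ≤ n k) (k : ℕ) :
    2 ^ (k + 1) ≤ cantorProd n k := by
  simpa [cantorProd] using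
    Finset.prod_le_prod (s := Finset.range (k + 1)) (f := fun _ => 2) (g := n)
      (fun _ _ => Nat.zero_le _) fun j _ => hn j

theorem cantorProd_pos {n : ℕ → ℕ} (hn : ∀ k, 2 ≤ n k) (k : ℕ) : 0 < cantorProd n k :=
  (pow_pos two_pos _).trans_le (two_pow_le_cantorProd hn k)

theorem log_cantorProd {n : ℕ → ℕ} (hn : ∀ k, 2 ≤ n k) (k : ℕ) :
    Real.log (cantorProd n k) = ∑ j ∈ Finset.range (k + 1), Real.log (n j) := by
  rw [cantorProd, Nat.cast_prod, Real.log_prod]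
  intro j _
  have := hn j
  positivity

theorem log_cantorProd_pos {n : ℕ → ℕ} (hn : ∀ k, 2 ≤ n k) (k : ℕ) :
    0 < Real.log (cantorProd n k) := by
  refine Real.log_pos ?_
  have : 2 ^ 1 ≤ cantorProd n k :=
    (Nat.pow_le_pow_right two_pos (by omega)).trans (two_pow_le_cantorProd hn k)
  exact_mod_cast (by omega : 1 < cantorProd n k)

theorem monotone_cantorProd {n : ℕ → ℕ} (hn : ∀ k, 2 ≤ n k) : Monotone (cantorProd n) := by
  refine monotone_nat_of_le_succ fun k => ?_
  rw [cantorProd_succ]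
  exact Nat.le_mul_of_pos_right _ (by have := hn (k + 1); omega)

theorem tendsto_cantorProd {n : ℕ → ℕ} (hn : ∀ k, 2 ≤ n k) :
    Tendsto (cantorProd n) atTop atTop :=
  tendsto_atTop_mono (fun k => (two_pow_le_cantorProd hn k).trans' (Nat.lt_two_pow_self).le)
    (tendsto_add_atTop_nat 1)

/-- The integer with the digits `α 0, …, α k` in the mixed radix system with bases `n`: it is the
rank, from the left, of the cylinder interval of these digits among the `cantorProd n k` ones. -/
def digitIndex (n : ℕ → ℕ) (α : (k : ℕ) → Fin (n k)) : ℕ → ℕ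
  | 0 => α 0
  | k + 1 => digitIndex n α k * n (k + 1) + α (k + 1)

theorem digitIndex_add_one_le (n : ℕ → ℕ) (α : (k : ℕ) → Fin (n k)) (k : ℕ) :
    digitIndex n α (k + 1) + 1 ≤ (digitIndex n α k + 1) * n (k + 1) := by
  have := (α (k + 1)).2
  rw [digitIndex]
  nlinarith

theorem digitIndex_lt (n : ℕ → ℕ) (α : (k : ℕ) → Fin (n k)) (k : ℕ) :
    digitIndex n α k < cantorProd n k := by
  induction k with
  | zero => rw [cantorProd_zero]; exact (α 0).2
  | succ k ih =>
    rw [cantorProd_succ]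
    exact (digitIndex_add_one_le n α k).trans (Nat.mul_le_mul_right _ ih)

theorem digitIndex_eq_iff (n : ℕ → ℕ) (α β : (k : ℕ) → Fin (n k)) (k : ℕ) :
    digitIndex n α k = digitIndex n β k ↔ ∀ j ∈ Finset.range (k + 1), α j = β j := by
  induction k with
  | zero => simp [digitIndex, Fin.ext_iff]
  | succ k ih =>
    rw [Finset.range_add_one, Finset.forall_mem_insert, ← ih, digitIndex, digitIndex]
    have h1 := (α (k + 1)).2
    have h2 := (β (k + 1)).2
    constructor
    · intro h
      have hpos : 0 < n (k + 1) := by omega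
      have hd := congrArg (· / n (k + 1)) h
      have hm := congrArg (· % n (k + 1)) h
      simp only [Nat.mul_add_mod', Nat.mod_eq_of_lt h1,
        Nat.mod_eq_of_lt h2] at hm
      simp only [mul_comm _ (n (k + 1)), Nat.mul_add_div hpos, Nat.div_eq_of_lt h1,
        Nat.div_eq_of_lt h2, add_zero] at hd
      exact ⟨Fin.ext hm, hd⟩
    · rintro ⟨h, h'⟩
      rw [h, h']

theorem sum_range_digit_div {n : ℕ → ℕ} (hn : ∀ k, 2 ≤ n k) (α : (k : ℕ) → Fin (n k)) (k : ℕ) :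
    ∑ j ∈ Finset.range (k + 1), ((α j : ℕ) : ℝ) / (cantorProd n j : ℝ) =
      digitIndex n α k / cantorProd n k := by
  induction k with
  | zero => simp [digitIndex]
  | succ k ih =>
    have h1 : (cantorProd n k : ℝ) ≠ 0 := by exact_mod_cast (cantorProd_pos hn k).ne'
    have h2 : (n (k + 1) : ℝ) ≠ 0 := by have := hn (k + 1); positivity
    rw [Finset.sum_range_succ, ih, digitIndex, cantorProd_succ]
    push_cast
    field_simp

theorem digitIndex_add_one_div_antitone {n : ℕ → ℕ} (hn : ∀ k, 2 ≤ n k)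
    (α : (k : ℕ) → Fin (n k)) :
    Antitone fun k => ((digitIndex n α k : ℝ) + 1) / cantorProd n k := by
  refine antitone_nat_of_succ_le fun k => ?_
  have h1 : (0 : ℝ) < cantorProd n k := by exact_mod_cast cantorProd_pos hn k
  have h2 : (0 : ℝ) < cantorProd n (k + 1) := by exact_mod_cast cantorProd_pos hn (k + 1)
  have h3 : ((digitIndex n α (k + 1) : ℝ) + 1) ≤ (digitIndex n α k + 1) * n (k + 1) := by
    exact_mod_cast digitIndex_add_one_le n α k
  rw [div_le_div_iff₀ h2 h1, cantorProd_succ]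
  push_cast
  nlinarith

theorem sum_range_digit_le {n : ℕ → ℕ} (hn : ∀ k, 2 ≤ n k) (α : (k : ℕ) → Fin (n k)) (k m : ℕ) :
    ∑ j ∈ Finset.range m, ((α j : ℕ) : ℝ) / (cantorProd n j : ℝ) ≤
      (digitIndex n α k + 1) / cantorProd n k := by
  have hmono : Monotone fun m => ∑ j ∈ Finset.range m, ((α j : ℕ) : ℝ) / (cantorProd n j : ℝ) := by
    refine monotone_nat_of_le_succ fun m => ?_
    rw [Finset.sum_range_succ]
    exact le_add_of_nonneg_right (by positivity)
  calc _ ≤ ∑ j ∈ Finset.range (max k m + 1), ((α j : ℕ) : ℝ) / (cantorProd n j : ℝ) :=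
        hmono ((le_max_right k m).trans (Nat.le_succ _))
    _ ≤ ((digitIndex n α (max k m) : ℝ) + 1) / cantorProd n (max k m) := by
        rw [sum_range_digit_div hn]
        gcongr
        linarith
    _ ≤ _ := digitIndex_add_one_div_antitone hn α (le_max_left k m)

theorem summable_digit_div {n : ℕ → ℕ} (hn : ∀ k, 2 ≤ n k) (α : (k : ℕ) → Fin (n k)) :
    Summable fun k => ((α k : ℕ) : ℝ) / (cantorProd n k : ℝ) :=
  summable_of_sum_range_le (fun _ => by positivity) fun m => sum_range_digit_le hn α 0 m

theorem digitIndex_le_cantorSum_mul {n : ℕ → ℕ} (hn : ∀ k, 2 ≤ n k) (α : (k : ℕ) → Fin (n k))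
    (k : ℕ) : (digitIndex n α k : ℝ) ≤ cantorSum n α * cantorProd n k := by
  have h1 : (0 : ℝ) < cantorProd n k := by exact_mod_cast cantorProd_pos hn k
  rw [← div_le_iff₀ h1, ← sum_range_digit_div hn]
  exact (summable_digit_div hn α).sum_le_tsum _ fun _ _ => by positivity

theorem cantorSum_mul_le_digitIndex_add_one {n : ℕ → ℕ} (hn : ∀ k, 2 ≤ n k)
    (α : (k : ℕ) → Fin (n k)) (k : ℕ) :
    cantorSum n α * cantorProd n k ≤ digitIndex n α k + 1 := by
  have h1 : (0 : ℝ) < cantorProd n k := by exact_mod_cast cantorProd_pos hn k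
  rw [← le_div_iff₀ h1]
  exact Real.tsum_le_of_sum_range_le (fun _ => by positivity) (sum_range_digit_le hn α k)

theorem measurable_digitIndex {Ω : Type*} [MeasurableSpace Ω] {n : ℕ → ℕ}
    {ξ : (k : ℕ) → Ω → Fin (n k)} (hmeas : ∀ k, Measurable (ξ k)) (k : ℕ) :
    Measurable fun ω => digitIndex n (fun k => ξ k ω) k := by
  have hd : ∀ k, Measurable fun ω => (ξ k ω : ℕ) :=
    fun k => (Measurable.of_discrete (f := fun i : Fin (n k) => (i : ℕ))).comp (hmeas k)
  induction k with
  | zero => exact hd 0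
  | succ k ih => exact (ih.mul_const _).add (hd (k + 1))

theorem measurable_cantorSum {Ω : Type*} [MeasurableSpace Ω] {n : ℕ → ℕ} (hn : ∀ k, 2 ≤ n k)
    {ξ : (k : ℕ) → Ω → Fin (n k)} (hmeas : ∀ k, Measurable (ξ k)) :
    Measurable fun ω => cantorSum n fun k => ξ k ω := by
  refine measurable_of_tendsto_metrizable
    (f := fun m ω => ∑ j ∈ Finset.range m, ((ξ j ω : ℕ) : ℝ) / (cantorProd n j : ℝ)) ?_ ?_
  · intro m
    refine Finset.measurable_sum _ fun j _ => ?_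
    exact (Measurable.of_discrete (f := fun i : Fin (n j) => ((i : ℕ) : ℝ) / cantorProd n j)).comp
      (hmeas j)
  · exact tendsto_pi_nhds.2 fun ω => (summable_digit_div hn fun k => ξ k ω).hasSum.tendsto_sum_nat

/-- The cylinder of the first `k + 1` digits has the product of the digit probabilities. -/
theorem measure_digitIndex_eq {Ω : Type*} [MeasurableSpace Ω] {P : Measure Ω}
    [IsProbabilityMeasure P] {n : ℕ → ℕ} {p : (k : ℕ) → Fin (n k) → ℝ}
    {ξ : (k : ℕ) → Ω → Fin (n k)} (hindep : iIndepFun ξ P)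
    (hdist : ∀ k i, P.real {ω | ξ k ω = i} = p k i) (α : (k : ℕ) → Fin (n k)) (k : ℕ) :
    P {ω | digitIndex n (fun k => ξ k ω) k = digitIndex n α k} =
      ENNReal.ofReal (∏ j ∈ Finset.range (k + 1), p j (α j)) := by
  have h : {ω | digitIndex n (fun k => ξ k ω) k = digitIndex n α k} =
      ⋂ j ∈ Finset.range (k + 1), ξ j ⁻¹' {α j} := by
    ext ω
    simp only [Set.mem_ofPred_eq, digitIndex_eq_iff, Set.mem_iInter, Set.mem_preimage,
      Set.mem_singleton_iff]
  have hp : ∀ j, P (ξ j ⁻¹' {α j}) = ENNReal.ofReal (p j (α j)) := fun j => by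
    rw [← hdist, ofReal_measureReal]; rfl
  rw [h, hindep.measure_inter_preimage_eq_mul _ fun j _ => measurableSet_singleton (α j),
    ENNReal.ofReal_prod_of_nonneg fun j _ => by rw [← hdist]; exact measureReal_nonneg]
  exact Finset.prod_congr rfl fun j _ => hp j

/-! ### Entropy and its second moment -/

/-- The comparison with `4 * p * log N ^ 2` holds for `N⁻² ≤ p`; for smaller `p` the bound
`|p ^ (1 / 4) * log p| < 4` leaves a factor `√p ≤ 1 / N`. -/
theorem mul_log_sq_le {p N : ℝ} (h0 : 0 ≤ p) (h1 : p ≤ 1) (hN : 1 ≤ N) :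
    p * Real.log p ^ 2 ≤ 4 * Real.log N ^ 2 * p + 16 * N⁻¹ := by
  have hN0 : 0 < N := by linarith
  rcases h0.eq_or_lt with rfl | hp
  · simp [hN0.le]
  rcases le_or_gt (N ^ 2)⁻¹ p with h | h
  · have hl := Real.log_le_log (by positivity) h
    rw [Real.log_inv, Real.log_pow] at hl
    push_cast at hl
    have hl0 := Real.log_nonpos h0 h1
    have : Real.log p ^ 2 ≤ 4 * Real.log N ^ 2 := by nlinarith
    have : 0 ≤ 16 * N⁻¹ := by positivity
    nlinarith
  · have h4 := Real.abs_log_mul_self_rpow_lt p (1 / 4) hp h1 (by norm_num)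
    have hsq : Real.log p ^ 2 * √p ≤ 16 := by
      have e : (p ^ (1 / 4 : ℝ)) ^ 2 = √p := by
        rw [← Real.rpow_natCast, ← Real.rpow_mul h0, Real.sqrt_eq_rpow]; norm_num
      rw [← e, ← mul_pow, ← sq_abs]
      have := abs_nonneg (Real.log p * p ^ (1 / 4 : ℝ))
      norm_num at h4 this ⊢
      nlinarith
    have hs : √p ≤ N⁻¹ := by
      rw [Real.sqrt_le_left (by positivity), inv_pow]; exact h.le
    have hpp : √p * √p = p := Real.mul_self_sqrt h0
    calc p * Real.log p ^ 2 = (Real.log p ^ 2 * √p) * √p := by rw [mul_assoc, hpp]; ring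
      _ ≤ 16 * N⁻¹ := by gcongr
      _ ≤ _ := le_add_of_nonneg_left (by positivity)

theorem sum_mul_log_sq_le {N : ℕ} (hN : 2 ≤ N) {p : Fin N → ℝ} (h0 : ∀ i, 0 ≤ p i)
    (h1 : ∑ i, p i = 1) : ∑ i, p i * Real.log (p i) ^ 2 ≤ 68 * Real.log N ^ 2 := by
  have hNR : (2 : ℝ) ≤ N := by exact_mod_cast hN
  calc ∑ i, p i * Real.log (p i) ^ 2
      ≤ ∑ i, (4 * Real.log N ^ 2 * p i + 16 * (N : ℝ)⁻¹) := by
        refine Finset.sum_le_sum fun i _ => mul_log_sq_le (h0 i) ?_ (by linarith)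
        rw [← h1]
        exact Finset.single_le_sum (fun i _ => h0 i) (Finset.mem_univ i)
    _ = 4 * Real.log N ^ 2 + 16 := by
        rw [Finset.sum_add_distrib, ← Finset.mul_sum, h1]
        simp
        field_simp
    _ ≤ _ := by
        have h2 : (1 / 2 : ℝ) ≤ Real.log N := by
          have := Real.log_two_gt_d9
          have := Real.log_le_log (by norm_num) hNR
          linarith
        nlinarith

/-! ### The strong law for the information of the digits -/

theorem integral_comp_digit {Ω : Type*} [MeasurableSpace Ω] {P : Measure Ω}
    [IsProbabilityMeasure P] {m : ℕ} {p : Fin m → ℝ} {ξ : Ω → Fin m} (hmeas : Measurable ξ)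
    (hdist : ∀ i, P.real {ω | ξ ω = i} = p i) (g : Fin m → ℝ) :
    ∫ ω, g (ξ ω) ∂P = ∑ i, p i * g i := by
  have := Measure.isProbabilityMeasure_map (μ := P) hmeas.aemeasurable
  rw [← integral_map (f := g) hmeas.aemeasurable (Measurable.of_discrete.aestronglyMeasurable),
    integral_fintype (Integrable.of_finite)]
  refine Finset.sum_congr rfl fun i _ => ?_
  rw [map_measureReal_apply hmeas (measurableSet_singleton i), smul_eq_mul, ← hdist]
  rfl

open scoped Topology in
/-- The information `-log p (ξ j)` of a digit has the mean `h j` and a second moment of order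
`log (n j) ^ 2`, so that the summability condition is exactly Kolmogorov's one for the norming
sequence `log (n 0 ⋯ n k)`. -/
theorem ae_tendsto_information_sub_entropySum {Ω : Type*} [MeasurableSpace Ω] {P : Measure Ω}
    [IsProbabilityMeasure P] {n : ℕ → ℕ} (hn : ∀ k, 2 ≤ n k) {p : (k : ℕ) → Fin (n k) → ℝ}
    {ξ : (k : ℕ) → Ω → Fin (n k)} (hmeas : ∀ k, Measurable (ξ k)) (hindep : iIndepFun ξ P)
    (hdist : ∀ k i, P.real {ω | ξ k ω = i} = p k i)
    (hsum : Summable fun k : ℕ =>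
      (Real.log (n k : ℝ) / Real.log (cantorProd n k : ℝ)) ^ 2) :
    ∀ᵐ ω ∂P, Tendsto (fun k => (∑ j ∈ Finset.range (k + 1), -Real.log (p j (ξ j ω)))
        / Real.log (cantorProd n k) - entropySum n p k / Real.log (cantorProd n k))
      atTop (𝓝 0) := by
  have hp0 : ∀ j i, 0 ≤ p j i := fun j i => by rw [← hdist]; exact measureReal_nonneg
  have hp1 : ∀ j, ∑ i, p j i = 1 := fun j => by
    simpa using (integral_comp_digit (hmeas j) (hdist j) fun _ => 1).symm
  set X : ℕ → Ω → ℝ := fun j ω => -Real.log (p j (ξ j ω)) with hX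
  have hXm : ∀ j, Measurable (X j) := fun j =>
    (Measurable.of_discrete (f := fun i => -Real.log (p j i))).comp (hmeas j)
  have hX2 : ∀ j, MemLp (X j) 2 P := fun j => by
    have := Measure.isProbabilityMeasure_map (μ := P) (hmeas j).aemeasurable
    exact (MemLp.of_discrete (f := fun i => -Real.log (p j i)) (μ := P.map (ξ j))).comp_of_map
      (hmeas j).aemeasurable
  have hXint : ∀ j, ∫ ω, X j ω ∂P = digitEntropy n p j := fun j => by
    rw [hX, integral_comp_digit (hmeas j) (hdist j) fun i => -Real.log (p j i)]
    simp [digitEntropy]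
  have hXvar : ∀ j, variance (X j) P ≤ 68 * Real.log (n j) ^ 2 := fun j => by
    refine (variance_le_expectation_sq (hXm j).aestronglyMeasurable).trans ?_
    have := integral_comp_digit (hmeas j) (hdist j) fun i => Real.log (p j i) ^ 2
    simp only [hX, Pi.pow_apply, neg_sq]
    rw [this]
    exact sum_mul_log_sq_le (hn j) (hp0 j) (hp1 j)
  have hb0 := log_cantorProd_pos hn
  have hbmono : Monotone fun k => Real.log (cantorProd n k) := fun i j hij =>
    Real.log_le_log (by exact_mod_cast cantorProd_pos hn i)
      (by exact_mod_cast monotone_cantorProd hn hij)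
  have hbtop : Tendsto (fun k => Real.log (cantorProd n k)) atTop atTop :=
    Real.tendsto_log_atTop.comp (tendsto_natCast_atTop_atTop.comp (tendsto_cantorProd hn))
  have hvar : Summable fun j => variance (X j) P / Real.log (cantorProd n j) ^ 2 := by
    refine Summable.of_nonneg_of_le (fun j => div_nonneg (variance_nonneg _ _) (sq_nonneg _))
      (fun j => ?_) (hsum.mul_left 68)
    rw [div_pow, ← mul_div_assoc]
    exact div_le_div_of_nonneg_right (hXvar j) (sq_nonneg _)
  filter_upwards [ae_tendsto_sum_sub_integral_div hXm hX2
    (hindep.comp (fun j i => -Real.log (p j i)) fun _ => .of_discrete) hb0 hbmono hbtop hvar]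
    with ω hω
  refine hω.congr fun k => ?_
  rw [Finset.sum_sub_distrib, sub_div]
  simp_rw [hXint]
  rfl

/-! ### The dimension of the distribution -/

/-- Since `log (n k) / log (n 0 ⋯ n k)` tends to `0`, consecutive scales are comparable up to an
arbitrarily small loss in the exponent. -/
theorem eventually_rpow_cantorProd_succ_le {n : ℕ → ℕ} (hn : ∀ k, 2 ≤ n k)
    (hsum : Summable fun k : ℕ =>
      (Real.log (n k : ℝ) / Real.log (cantorProd n k : ℝ)) ^ 2) {s t : ℝ} (ht : 0 ≤ t)
    (hts : t < s) :
    ∀ᶠ k in atTop, (cantorProd n (k + 1) : ℝ) ^ t ≤ (cantorProd n k : ℝ) ^ s := by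
  have hs : 0 < s := ht.trans_lt hts
  have hlim := (tendsto_add_atTop_iff_nat 1).2 hsum.tendsto_atTop_zero
  have hε : 0 < 1 - t / s := by rw [sub_pos, div_lt_one hs]; exact hts
  filter_upwards [hlim.eventually (gt_mem_nhds (pow_pos hε 2))] with k hk
  have hb := log_cantorProd_pos hn (k + 1)
  have hk' := (lt_of_pow_lt_pow_left₀ 2 hε.le hk).le
  rw [div_le_iff₀ hb] at hk'
  have hsucc : Real.log (cantorProd n (k + 1)) =
      Real.log (cantorProd n k) + Real.log (n (k + 1)) := by
    rw [log_cantorProd hn, log_cantorProd hn, Finset.sum_range_succ]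
  have hN : ∀ k, (0 : ℝ) < cantorProd n k := fun k => by exact_mod_cast cantorProd_pos hn k
  rw [Real.rpow_def_of_pos (hN _), Real.rpow_def_of_pos (hN _), Real.exp_le_exp]
  have h1 : t / s * Real.log (cantorProd n (k + 1)) ≤ Real.log (cantorProd n k) := by linarith
  calc Real.log (cantorProd n (k + 1)) * t
      = t / s * Real.log (cantorProd n (k + 1)) * s := by field_simp
    _ ≤ _ := by gcongr

theorem ae_digit_prob_pos {Ω : Type*} [MeasurableSpace Ω] {P : Measure Ω}
    [IsProbabilityMeasure P] {n : ℕ → ℕ} {p : (k : ℕ) → Fin (n k) → ℝ}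
    {ξ : (k : ℕ) → Ω → Fin (n k)}
    (hdist : ∀ k i, P.real {ω | ξ k ω = i} = p k i) : ∀ᵐ ω ∂P, ∀ j, 0 < p j (ξ j ω) := by
  rw [ae_all_iff]
  intro j
  have h : ∀ i, ∀ᵐ ω ∂P, ξ j ω = i → 0 < p j i := by
    intro i
    rcases (measureReal_nonneg (μ := P) (s := {ω | ξ j ω = i})).eq_or_lt with h0 | h0
    · have h0' : P {ω | ξ j ω = i} = 0 := (measureReal_eq_zero_iff).1 h0.symm
      filter_upwards [measure_eq_zero_iff_ae_notMem.1 h0'] with ω h1 h2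
      exact absurd h2 h1
    · exact Eventually.of_forall fun _ _ => hdist j i ▸ h0
  filter_upwards [ae_all_iff.2 h] with ω hω
  exact hω _ rfl

theorem propositionH {Ω : Type*} [MeasurableSpace Ω] (P : Measure Ω) [IsProbabilityMeasure P]
    (n : ℕ → ℕ) (hn : ∀ k, 2 ≤ n k)
    (p : (k : ℕ) → Fin (n k) → ℝ)
    (ξ : (k : ℕ) → Ω → Fin (n k))
    (hmeas : ∀ k, Measurable (ξ k))
    (hindep : iIndepFun ξ P)
    (hdist : ∀ k i, P.real {ω | ξ k ω = i} = p k i)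
    (hsum : Summable fun k : ℕ =>
      (Real.log (n k : ℝ) / Real.log (cantorProd n k : ℝ)) ^ 2) :
    measureDimH (P.map fun ω => cantorSum n fun k => ξ k ω) =
      liminf (fun k : ℕ =>
        ENNReal.ofReal (entropySum n p k / Real.log (cantorProd n k : ℝ))) atTop := by
  have hXm := measurable_cantorSum hn hmeas
  have hZ := measurable_digitIndex hmeas
  have hle := fun k ω => digitIndex_le_cantorSum_mul hn (fun k => ξ k ω) k
  have hge := fun k ω => cantorSum_mul_le_digitIndex_add_one hn (fun k => ξ k ω) k
  have hb := log_cantorProd_pos hn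
  have hN : ∀ k, (0 : ℝ) < cantorProd n k := fun k => by exact_mod_cast cantorProd_pos hn k
  -- Almost surely the cylinder probabilities are exponentials of the accumulated information.
  have hprob : ∀ᵐ ω ∂P, ∀ k,
      P {ω' | digitIndex n (fun k => ξ k ω') k = digitIndex n (fun k => ξ k ω) k} =
        ENNReal.ofReal (Real.exp (-∑ j ∈ Finset.range (k + 1), -Real.log (p j (ξ j ω)))) := by
    filter_upwards [ae_digit_prob_pos hdist] with ω hω k
    rw [measure_digitIndex_eq hindep hdist, Finset.sum_neg_distrib, neg_neg, Real.exp_sum]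
    congr 1
    exact Finset.prod_congr rfl fun j _ => (Real.exp_log (hω j)).symm
  have hslln := ae_tendsto_information_sub_entropySum hn hmeas hindep hdist hsum
  refine le_antisymm ?_ ?_
  -- Upper bound: infinitely often the information is below `s * log (n 0 ⋯ n k)`.
  · refine le_of_forall_gt fun u hu => ?_
    obtain ⟨s, hs, hsu⟩ := ENNReal.lt_iff_exists_nnreal_btwn.1 hu
    obtain ⟨r, hr, hrs⟩ := ENNReal.lt_iff_exists_nnreal_btwn.1 hs
    have hrs' : (r : ℝ) < s := by exact_mod_cast hrs
    obtain ⟨E, hE, hE1, hdim⟩ := exists_dimH_le_of_ae_frequently_le_measure hXm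
      (fun k => (Nat.pow_le_pow_right two_pos k.le_succ).trans (two_pow_le_cantorProd hn k))
      hZ hle hge (fun k ω => digitIndex_lt n _ k) (s := s) (by
        filter_upwards [hprob, hslln] with ω h1 h2
        have h3 := frequently_lt_of_liminf_lt (by isBoundedDefault) hr
        refine (h3.and_eventually (h2.eventually (gt_mem_nhds (sub_pos.2 hrs')))).mono ?_
        rintro k ⟨hk1, hk2⟩
        rw [h1, Real.rpow_def_of_pos (hN k)]
        refine ENNReal.ofReal_le_ofReal (Real.exp_le_exp.2 ?_)
        rw [← ENNReal.ofReal_coe_nnreal] at hk1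
        have hk1' := (ENNReal.ofReal_lt_ofReal_iff'.1 hk1).1
        have h4 : (∑ j ∈ Finset.range (k + 1), -Real.log (p j (ξ j ω)))
            / Real.log (cantorProd n k) < s := by linarith
        rw [div_lt_iff₀ (hb k)] at h4
        linarith)
    exact (iInf₂_le_of_le E hE (iInf_le_of_le hE1 hdim)).trans_lt hsu
  -- Lower bound: eventually the information is above `s * log (n 0 ⋯ n k)`.
  · refine le_iInf₂ fun E hE => le_iInf fun hE1 => ?_
    refine le_of_forall_lt fun u hu => ?_
    obtain ⟨t, hut, ht⟩ := ENNReal.lt_iff_exists_nnreal_btwn.1 hu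
    obtain ⟨s, hts, hs⟩ := ENNReal.lt_iff_exists_nnreal_btwn.1 ht
    obtain ⟨r, hsr, hr⟩ := ENNReal.lt_iff_exists_nnreal_btwn.1 hs
    have hts' : (t : ℝ) < s := by exact_mod_cast hts
    have hsr' : (s : ℝ) < r := by exact_mod_cast hsr
    refine hut.trans_le (le_dimH_of_ae_eventually_measure_le hXm (cantorProd_pos hn)
      (tendsto_cantorProd hn) hZ hle hge (t.2.trans_lt hts')
      (eventually_rpow_cantorProd_succ_le hn hsum t.2 hts') ?_ hE hE1)
    filter_upwards [hprob, hslln] with ω h1 h2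
    have h3 := eventually_lt_of_lt_liminf hr (by isBoundedDefault)
    filter_upwards [h3, h2.eventually (lt_mem_nhds (sub_neg.2 hsr'))] with k hk1 hk2
    rw [h1, Real.rpow_def_of_pos (hN k)]
    refine ENNReal.ofReal_le_ofReal (Real.exp_le_exp.2 ?_)
    have hk1' : (r : ℝ) < entropySum n p k / Real.log (cantorProd n k) := by
      rw [← ENNReal.ofReal_coe_nnreal] at hk1
      exact (ENNReal.ofReal_lt_ofReal_iff'.1 hk1).1
    have h4 : s < (∑ j ∈ Finset.range (k + 1), -Real.log (p j (ξ j ω)))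
        / Real.log (cantorProd n k) := by linarith
    rw [lt_div_iff₀ (hb k)] at h4
    linarith
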